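/- Let $n,r\ge 1$ be integers. There exist a real constant $C$ and an integer $d$, depending only on $n$ and $r$, with the following property. Let $Q\subset\mathbb{R}^n$ be a closed cube (of positive side length, with sides parallel to the coordinate axes), and let $\mathcal{H}^0=(H^0_x)_{x\in Q}$ be any family of vector subspaces $H^0_x\subseteq\mathbb{R}^r$. Then there exist finite sets $S(x)\subset Q$ $(x\in Q)$, each containing at most $d$ points, and linear maps $A(x,y):\mathbb{R}^r\to\mathbb{R}^r$ $(x\in Q,\ y\in S(x))$, determined by $\mathcal{H}^0$ alone, such that the following holds. Let $(v(x))_{x\in Q}$ be any family of vectors in $\mathbb{R}^r$ with $v(x)\perp H^0_x$ for all $x\in Q$ (standard inner product), such that the family of affine subspaces $H_x=v(x)+H^0_x$ $(x\in Q)$ is Glaeser stable, i.e. it equals its own Glaeser refinement: for every $x\in Q$, $$H_x=\{p\in H_x:\ \operatorname{dist}(p,H_y)\to 0\ \text{ as } y\to x,\ y\in Q\}.$$ Then the function $$F(x)=\sum_{y\in S(x)}A(x,y)\,v(y)\qquad(x\in Q)$$ is a section of $(H_x)_{x\in Q}$, that is, $F:Q\to\mathbb{R}^r$ is continuous and $F(x)\in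 v(x)+H^0_x$ for every $x\in Q$. Moreover $\sup_{x\in Q}|v(x)|<\infty$ and $$\max_{x\in Q}|F(x)|\le C\,\sup_{x\in Q}|v(x)|.$$ -/

import Mathlib

/-- A singular affine bundle over `X`: a family of affine subspaces of `ℝ^r`
(`⊥`, the empty affine subspace, is allowed as a fiber). -/
abbrev SingularAffineBundle (X : Type*) (r : ℕ) : Type _ :=
  X → AffineSubspace ℝ (EuclideanSpace ℝ (Fin r))

/-- A homogeneous bundle over `X`: a family of vector subspaces of `ℝ^r`. -/
abbrev HomogeneousBundle (X : Type*) (r : ℕ) : Type _ :=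
  X → Submodule ℝ (EuclideanSpace ℝ (Fin r))

namespace SingularAffineBundle

variable {X : Type*} {r : ℕ}

/-- The bundle `(v(x) + H⁰_x)_{x ∈ X}`. -/
noncomputable def translate (v : X → EuclideanSpace ℝ (Fin r)) (H₀ : HomogeneousBundle X r) :
    SingularAffineBundle X r :=
  fun x => AffineSubspace.mk' (v x) (H₀ x)

theorem infEDist_combination_le (K : AffineSubspace ℝ (EuclideanSpace ℝ (Fin r))) (t : ℝ)
    (a b c : EuclideanSpace ℝ (Fin r)) :
    Metric.infEDist (t • (a - b) + c) (K : Set (EuclideanSpace ℝ (Fin r))) ≤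
      (‖t‖₊ : ENNReal) * (Metric.infEDist a K + Metric.infEDist b K) + Metric.infEDist c K := by
  rcases (K : Set (EuclideanSpace ℝ (Fin r))).eq_empty_or_nonempty with h | ⟨p, hp⟩
  · simp [h]
  · have hne : (K : Set (EuclideanSpace ℝ (Fin r))).Nonempty := ⟨p, hp⟩
    refine ENNReal.le_of_forall_pos_le_add fun ε hε _ => ?_
    set δ : NNReal := ε / (2 * ‖t‖₊ + 1) with hδ
    have hδ0 : (δ : ENNReal) ≠ 0 := by
      have : 0 < δ := by positivity
      exact_mod_cast this.ne'
    have key : ∀ z : EuclideanSpace ℝ (Fin r),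
        ∃ w ∈ (K : Set (EuclideanSpace ℝ (Fin r))), edist z w < Metric.infEDist z K + δ :=
      fun z => Metric.infEDist_lt_iff.1
        (ENNReal.lt_add_right (Metric.infEDist_ne_top hne) hδ0)
    obtain ⟨a', ha', hda⟩ := key a
    obtain ⟨b', hb', hdb⟩ := key b
    obtain ⟨c', hc', hdc⟩ := key c
    have hmem : t • (a' - b') + c' ∈ (K : Set (EuclideanSpace ℝ (Fin r))) := by
      simpa using K.smul_vsub_vadd_mem t ha' hb' hc'
    have hεδ : (ε : ENNReal) = (‖t‖₊ : ENNReal) * (δ + δ) + δ := by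
      have : ε = ‖t‖₊ * (δ + δ) + δ := by
        rw [hδ]; field_simp; ring
      exact_mod_cast this
    calc Metric.infEDist (t • (a - b) + c) K
        ≤ edist (t • (a - b) + c) (t • (a' - b') + c') := Metric.infEDist_le_edist_of_mem hmem
      _ ≤ edist (t • (a - b)) (t • (a' - b')) + edist c c' := edist_add_add_le _ _ _ _
      _ ≤ (‖t‖₊ : ENNReal) * (edist a a' + edist b b') + edist c c' := by
          gcongr
          rw [edist_smul₀, ENNReal.smul_def, smul_eq_mul]
          gcongr
          simpa [sub_eq_add_neg, edist_neg_neg] using edist_add_add_le a (-b) a' (-b')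
      _ ≤ (‖t‖₊ : ENNReal) * ((Metric.infEDist a K + δ) + (Metric.infEDist b K + δ))
            + (Metric.infEDist c K + δ) := by gcongr
      _ = _ := by rw [hεδ]; ring

/-- The Glaeser refinement: the fiber at `x` is the set of `p ∈ H_x` with
`dist(p, H_y) → 0` as `y → x`. The distance is `[0, ∞]`-valued, so that the distance to an
empty fiber is `∞`. -/
noncomputable def glaeserRefinement [TopologicalSpace X] (H : SingularAffineBundle X r) :
    SingularAffineBundle X r := fun x =>
  { carrier := {p | p ∈ H x ∧
      Filter.Tendsto (fun y => Metric.infEDist p (H y : Set (EuclideanSpace ℝ (Fin r))))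
        (nhds x) (nhds 0)}
    smul_vsub_vadd_mem' := by
      rintro t a b c ⟨ha, hda⟩ ⟨hb, hdb⟩ ⟨hc, hdc⟩
      refine ⟨(H x).smul_vsub_vadd_mem t ha hb hc, ?_⟩
      have h := (ENNReal.Tendsto.const_mul (hda.add hdb)
        (Or.inr (ENNReal.coe_ne_top (r := ‖t‖₊)))).add hdc
      simp only [add_zero, mul_zero] at h
      exact tendsto_of_tendsto_of_tendsto_of_le_of_le tendsto_const_nhds h
        (fun _ => zero_le) (fun y => infEDist_combination_le (H y) t a b c) }

/-- A bundle is Glaeser stable if it is its own Glaeser refinement. -/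
def IsGlaeserStable [TopologicalSpace X] (H : SingularAffineBundle X r) : Prop :=
  H.glaeserRefinement = H

/-- A section of a bundle: a continuous map with values in the fibers. -/
def IsSection [TopologicalSpace X] (H : SingularAffineBundle X r)
    (f : X → EuclideanSpace ℝ (Fin r)) : Prop :=
  Continuous f ∧ ∀ x, f x ∈ H x

end SingularAffineBundle

/-- The closed cube in `ℝ^n` with center `c`, side length `δ`, and sides parallel to the
coordinate axes. -/
def closedCube {n : ℕ} (c : EuclideanSpace ℝ (Fin n)) (δ : ℝ) :
    Set (EuclideanSpace ℝ (Fin n)) :=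
  {x | ∀ i, |x i - c i| ≤ δ / 2}

/-! Write `P_x` for the orthogonal projection onto `H⁰_x`. The point of `H_y` nearest to `p` is
`v(y) + P_y p`, so stability says `v(y) + P_y p → p` as `y → x` for each `p ∈ H_x`. Subtracting two
such limits gives `P_y h → h` for `h ∈ H⁰_x`. Hence `dim H⁰` is lower semicontinuous and `E_k = {dim
H⁰ < k}` is closed.

Sections are built by induction on `k`. Given an operator `T` on `E_k`, average its values at points
of `E_k` with Whitney weights to get `G` off `E_k`, and put `F(x) = v(x) + P_x G(x)` there. Near `x
∈ E_k`, `G` is close to `T x v ∈ H_x`, so `F` is close to `v(y) + P_y (T x v)`, which tends to `T x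
v`. On the new stratum `dim H⁰ = k` both `P` and `v` are continuous, by a trace computation
(`IsLscFamily.tendsto_starProjection`).

The construction is linear in `v` and its weights depend on `H⁰` alone. Each step adds 1 to the norm
bound and changes the depth from `d` to `1 + 5^n d`; after `r + 1` steps every fiber is covered. -/

open Filter Topology

/-! ### Whitney partitions of unity with bounded overlap -/

section Whitney

variable {V : Type*} [NormedAddCommGroup V] [NormedSpace ℝ V] [FiniteDimensional ℝ V] {X : Set V}

/-- In a set of points of norm distance at most `2 * a` from `x` and pairwise at distance at
least `a`, there are at most `5 ^ dim V` points. -/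
theorem finite_of_separated (x : X) {a : ℝ} (ha : 0 < a) (T : Set X)
    (hT : ∀ p ∈ T, dist p x ≤ 2 * a) (hsep : ∀ p ∈ T, ∀ q ∈ T, p ≠ q → a ≤ dist p q) :
    ∃ s : Finset X, (s : Set X) = T ∧ s.card ≤ 5 ^ Module.finrank ℝ V := by
  classical
  have key : ∀ s : Finset X, (s : Set X) ⊆ T → s.card ≤ 5 ^ Module.finrank ℝ V := by
    intro s hs
    have hinj : Function.Injective fun p : X => a⁻¹ • ((p : V) - x) := by
      intro p q h
      have := smul_right_injective V (inv_ne_zero ha.ne') h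
      exact Subtype.ext (sub_left_injective this)
    rw [← Finset.card_image_of_injective s hinj]
    apply Besicovitch.card_le_of_separated
    · intro c hc
      obtain ⟨p, hp, rfl⟩ := Finset.mem_image.1 hc
      have := hT p (hs hp)
      rw [Subtype.dist_eq, dist_eq_norm] at this
      rw [norm_smul, norm_inv, Real.norm_of_nonneg ha.le, inv_mul_le_iff₀ ha]
      linarith
    · intro c hc d hd hcd
      obtain ⟨p, hp, rfl⟩ := Finset.mem_image.1 hc
      obtain ⟨q, hq, rfl⟩ := Finset.mem_image.1 hd
      have := hsep p (hs hp) q (hs hq) (fun h => hcd (by rw [h]))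
      rw [Subtype.dist_eq, dist_eq_norm] at this
      rw [← smul_sub, sub_sub_sub_cancel_right, norm_smul, norm_inv, Real.norm_of_nonneg ha.le,
        le_inv_mul_iff₀ ha]
      linarith
  have hfin : T.Finite := by
    by_contra h
    obtain ⟨s, hs, hc⟩ := Set.Infinite.exists_subset_card_eq h (5 ^ Module.finrank ℝ V + 1)
    have := key s hs
    omega
  exact ⟨hfin.toFinset, hfin.coe_toFinset, key _ hfin.coe_toFinset.subset⟩

/-- A maximal set of points of `Eᶜ` whose mutual distances are comparable to the distance
to `E`. -/
theorem exists_maximal_separated {Y : Type*} [MetricSpace Y] (ρ : Y → ℝ) {E : Set Y}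
    (hρ : ∀ x ∉ E, 0 < ρ x) :
    ∃ P : Set Y, P ⊆ Eᶜ ∧ (∀ p ∈ P, ∀ q ∈ P, p ≠ q → ρ p / 8 ≤ dist p q) ∧
      ∀ x ∉ E, ∃ p ∈ P, dist x p < ρ x / 8 ∨ dist x p < ρ p / 8 := by
  obtain ⟨P, hP⟩ := zorn_subset
    {P : Set Y | P ⊆ Eᶜ ∧ ∀ p ∈ P, ∀ q ∈ P, p ≠ q → ρ p / 8 ≤ dist p q} (by
      intro c hc hchain
      refine ⟨⋃₀ c, ⟨Set.sUnion_subset fun s hs => (hc hs).1, ?_⟩,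
        fun s hs => Set.subset_sUnion_of_mem hs⟩
      rintro p ⟨s, hs, hp⟩ q ⟨t, ht, hq⟩ hpq
      rcases hchain.total hs ht with h | h
      · exact (hc ht).2 p (h hp) q hq hpq
      · exact (hc hs).2 p hp q (h hq) hpq)
  refine ⟨P, hP.prop.1, hP.prop.2, fun x hx => ?_⟩
  by_contra! hcon
  have hmem : insert x P ∈
      {P : Set Y | P ⊆ Eᶜ ∧ ∀ p ∈ P, ∀ q ∈ P, p ≠ q → ρ p / 8 ≤ dist p q} := by
    refine ⟨Set.insert_subset hx hP.prop.1, ?_⟩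
    rintro p (rfl | hp) q (rfl | hq) hpq
    · exact absurd rfl hpq
    · exact (hcon q hq).1
    · rw [dist_comm]; exact (hcon p hp).2
    · exact hP.prop.2 p hp q hq hpq
  have hxP : x ∈ P := hP.le_of_ge hmem (Set.subset_insert x P) (Set.mem_insert x P)
  have := (hcon x hxP).1
  rw [dist_self] at this
  linarith [hρ x hx]

/-- A Whitney partition of unity on the complement of a closed set `E`, of overlap at most
`5 ^ dim V`: the weight `w x p` is attached to a point `π p` of `E`, whose distance to `x` is
comparable to the distance from `x` to `E`. -/
theorem exists_whitney_partition {E : Set X} (hE : IsClosed E) (hne : E.Nonempty) :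
    ∃ (w : X → X → ℝ) (π : X → X), (∀ p, π p ∈ E) ∧ (∀ x p, 0 ≤ w x p) ∧
      (∀ x ∉ E, ∃ s : Finset X, s.card ≤ 5 ^ Module.finrank ℝ V ∧
        ∀ᶠ z in 𝓝 x, (∀ p ∉ s, w z p = 0) ∧ ∑ p ∈ s, w z p = 1) ∧
      (∀ x ∉ E, ∀ p, ContinuousAt (fun z => w z p) x) ∧
      ∀ x ∉ E, ∀ p, w x p ≠ 0 → dist x (π p) ≤ 3 * Metric.infDist x E := by
  classical
  set ρ : X → ℝ := fun x => Metric.infDist x E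
  have hρ : ∀ x ∉ E, 0 < ρ x := fun x hx => (hE.notMem_iff_infDist_pos hne).1 hx
  have hρ0 : ∀ x, 0 ≤ ρ x := fun x => Metric.infDist_nonneg
  have hlip : ∀ x y, ρ x ≤ ρ y + dist x y := fun x y => Metric.infDist_le_infDist_add_dist
  obtain ⟨P, hPE, hPsep, hPcov⟩ := exists_maximal_separated ρ hρ
  have hπ : ∀ p : X, ∃ y ∈ E, p ∉ E → dist p y < 2 * ρ p := by
    intro p
    by_cases hp : p ∈ E
    · exact ⟨p, hp, fun h => absurd hp h⟩
    · obtain ⟨y, hy, hd⟩ := (Metric.infDist_lt_iff hne).1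
        (show Metric.infDist p E < 2 * ρ p by linarith [hρ p hp])
      exact ⟨y, hy, fun _ => hd⟩
  choose π hπE hπd using hπ
  -- Radius `ρ p / 7` suffices: if `dist x p < ρ x / 8`, then `ρ x ≤ ρ p + dist x p` gives `dist x p
  -- < ρ p / 7`.
  set f : X → X → ℝ := fun x p => if p ∈ P then max 0 (ρ p / 7 - dist x p) else 0 with hf
  have hf0 : ∀ x p, 0 ≤ f x p := by
    intro x p; simp only [hf]; split_ifs <;> simp
  have hfc : ∀ p, Continuous fun x => f x p := by
    intro p; simp only [hf]; split_ifs <;> fun_prop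
  have hfne : ∀ x p, f x p ≠ 0 → p ∈ P ∧ dist x p < ρ p / 7 := by
    intro x p h
    by_cases hp : p ∈ P
    · refine ⟨hp, ?_⟩
      by_contra! hd
      exact h (by simp [hf, hp, hd])
    · exact absurd (by simp [hf, hp]) h
  have hfpos : ∀ x ∉ E, ∃ p, 0 < f x p := by
    intro x hx
    obtain ⟨p, hp, h⟩ := hPcov x hx
    refine ⟨p, ?_⟩
    have h1 := hlip x p
    have h2 := hρ p (hPE hp)
    simp only [hf, if_pos hp]
    refine lt_max_of_lt_right ?_
    rcases h with h | h <;> linarith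
  have hloc : ∀ x ∉ E, ∃ s : Finset X, s.card ≤ 5 ^ Module.finrank ℝ V ∧
      ∀ᶠ z in 𝓝 x, z ∉ E ∧ ∀ p ∉ s, f z p = 0 := by
    intro x hx
    have hx0 := hρ x hx
    -- Bumps active near `x` have `ρ p` between `3/4 ρ x` and `6/5 ρ x`. Their centers are thus
    -- `3/32 ρ x`-separated and within twice that distance of `x`, as the packing bound requires.
    have hbd : ∀ p, (∃ z, dist z x < ρ x / 100 ∧ f z p ≠ 0) →
        p ∈ P ∧ dist p x ≤ 2 * (3 / 32 * ρ x) ∧ 3 / 32 * ρ x ≤ ρ p / 8 := by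
      rintro p ⟨z, hz, hzp⟩
      obtain ⟨hp, hd⟩ := hfne z p hzp
      have h1 := hlip z p
      have h2 := hlip p z
      have h3 := hlip z x
      have h4 := hlip x z
      have h5 := dist_triangle p z x
      rw [dist_comm p z] at h2 h5
      rw [dist_comm x z] at h4
      exact ⟨hp, by linarith, by linarith⟩
    obtain ⟨s, hs, hcard⟩ := finite_of_separated x (a := 3 / 32 * ρ x) (by positivity)
      {p | ∃ z, dist z x < ρ x / 100 ∧ f z p ≠ 0} (fun p hp => (hbd p hp).2.1)
      (fun p hp q hq hpq =>
        (hbd p hp).2.2.trans (hPsep p (hbd p hp).1 q (hbd q hq).1 hpq))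
    refine ⟨s, hcard, ?_⟩
    filter_upwards [Metric.ball_mem_nhds x (show 0 < ρ x / 100 by positivity),
      hE.isOpen_compl.mem_nhds hx] with z hz hzE
    refine ⟨hzE, fun p hp => ?_⟩
    by_contra h
    exact hp (by rw [← Finset.mem_coe, hs]; exact ⟨z, hz, h⟩)
  set Φ : X → ℝ := fun x => ∑ᶠ p, f x p
  have hΦs : ∀ (s : Finset X) z, (∀ p ∉ s, f z p = 0) → Φ z = ∑ p ∈ s, f z p := by
    intro s z h
    refine finsum_eq_sum_of_support_subset _ fun p hp => ?_
    by_contra hps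
    exact hp (h p hps)
  have hΦpos : ∀ x ∉ E, 0 < Φ x := by
    intro x hx
    obtain ⟨s, -, hs⟩ := hloc x hx
    have h := hs.self_of_nhds.2
    obtain ⟨p, hp⟩ := hfpos x hx
    rw [hΦs s x h]
    refine Finset.sum_pos' (fun q _ => hf0 x q) ⟨p, ?_, hp⟩
    by_contra hps
    exact hp.ne' (h p hps)
  refine ⟨fun x p => f x p / Φ x, π, hπE,
    fun x p => div_nonneg (hf0 x p) (finsum_nonneg (hf0 x)), ?_, ?_, ?_⟩
  · intro x hx
    obtain ⟨s, hcard, hs⟩ := hloc x hx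
    refine ⟨s, hcard, ?_⟩
    filter_upwards [hs] with z hz
    refine ⟨fun p hp => by simp [hz.2 p hp], ?_⟩
    rw [← Finset.sum_div, ← hΦs s z hz.2, div_self (hΦpos z hz.1).ne']
  · intro x hx p
    obtain ⟨s, -, hs⟩ := hloc x hx
    have hΦc : ContinuousAt Φ x := by
      have h : Φ =ᶠ[𝓝 x] fun z => ∑ p ∈ s, f z p := hs.mono fun z hz => hΦs s z hz.2
      exact ContinuousAt.congr (by fun_prop) h.symm
    exact (hfc p).continuousAt.div hΦc (hΦpos x hx).ne'
  · intro x hx p hp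
    obtain ⟨hpP, hd⟩ := hfne x p (fun h => hp (by simp [h]))
    have h1 := hlip p x
    have h2 := hπd p (hPE hpP)
    have h3 := dist_triangle x p (π p)
    rw [dist_comm p x] at h1
    have h4 := hρ0 x
    change dist x (π p) ≤ 3 * ρ x
    linarith

end Whitney

/-! ### Lower semicontinuous families of subspaces -/

section Projections

variable {W : Type*} [NormedAddCommGroup W] [InnerProductSpace ℝ W] [FiniteDimensional ℝ W]

theorem trace_starProjection (K : Submodule ℝ W) :
    LinearMap.trace ℝ W (K.starProjection : W →ₗ[ℝ] W) = Module.finrank ℝ K :=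
  LinearMap.IsProj.trace
    ⟨fun x => K.starProjection_apply_mem x, fun _ hx => K.starProjection_eq_self_iff.2 hx⟩

/-- The squared Hilbert–Schmidt distance of two orthogonal projections. -/
theorem sum_norm_sq_starProjection_sub {ι : Type*} [Fintype ι] (b : OrthonormalBasis ι ℝ W)
    (K L : Submodule ℝ W) :
    ∑ i, ‖K.starProjection (b i) - L.starProjection (b i)‖ ^ 2 =
      Module.finrank ℝ K + Module.finrank ℝ L -
        2 * ∑ i, inner ℝ (b i) (K.starProjection (L.starProjection (b i))) := by
  rw [← trace_starProjection K, ← trace_starProjection L, LinearMap.trace_eq_sum_inner _ b,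
    LinearMap.trace_eq_sum_inner _ b, ← Finset.sum_add_distrib, Finset.mul_sum,
    ← Finset.sum_sub_distrib]
  refine Finset.sum_congr rfl fun i _ => ?_
  have h : ∀ M : Submodule ℝ W, ‖M.starProjection (b i)‖ ^ 2 =
      inner ℝ (b i) (M.starProjection (b i)) := by
    intro M
    rw [← real_inner_self_eq_norm_sq, M.inner_starProjection_left_eq_right,
      M.starProjection_eq_self_iff.2 (M.starProjection_apply_mem _)]
  rw [norm_sub_sq_real, h, h, K.inner_starProjection_left_eq_right]
  simp only [ContinuousLinearMap.coe_coe]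
  ring

variable {Y : Type*} [TopologicalSpace Y] {H : Y → Submodule ℝ W}

/-- A family of subspaces is lower semicontinuous if every vector of a fiber is a limit of its
projections to the neighboring fibers. -/
def IsLscFamily (H : Y → Submodule ℝ W) : Prop :=
  ∀ x, ∀ h ∈ H x, Tendsto (fun y => (H y).starProjection h) (𝓝 x) (𝓝 h)

/-- The sum is `tr (P_y P_x)`; since `P_y` converges to the identity on `H x`, its limit is `tr P_x
= dim H x`. -/
theorem IsLscFamily.tendsto_sum_inner (hH : IsLscFamily H) (x : Y) {ι : Type*} [Fintype ι]
    (b : OrthonormalBasis ι ℝ W) :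
    Tendsto (fun y => ∑ i, inner ℝ (b i) ((H y).starProjection ((H x).starProjection (b i))))
      (𝓝 x) (𝓝 (Module.finrank ℝ (H x))) := by
  rw [← trace_starProjection (H x), LinearMap.trace_eq_sum_inner _ b]
  exact tendsto_finsetSum _ fun i _ =>
    tendsto_const_nhds.inner (hH x _ ((H x).starProjection_apply_mem _))

theorem IsLscFamily.isClosed_finrank_lt (hH : IsLscFamily H) (k : ℕ) :
    IsClosed {x | Module.finrank ℝ (H x) < k} := by
  rw [← isOpen_compl_iff, isOpen_iff_mem_nhds]
  intro x hx
  simp only [Set.mem_compl_iff, Set.mem_ofPred_eq, not_lt] at hx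
  let b := stdOrthonormalBasis ℝ W
  -- Nonnegativity of the Hilbert–Schmidt distance gives `dim H y ≥ 2 tr (P_y P_x) - dim H x`. A
  -- margin of `1/2` makes this exceed `dim H x - 1`, enough for integers.
  have h := (hH.tendsto_sum_inner x b).eventually
    (lt_mem_nhds (show (Module.finrank ℝ (H x) : ℝ) - 1 / 2 < _ by linarith))
  filter_upwards [h] with y hy
  simp only [Set.mem_compl_iff, Set.mem_ofPred_eq, not_lt]
  have h1 := sum_norm_sq_starProjection_sub b (H y) (H x)
  have h2 : 0 ≤ ∑ i, ‖(H y).starProjection (b i) - (H x).starProjection (b i)‖ ^ 2 := by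
    positivity
  have h3 : (Module.finrank ℝ (H x) : ℝ) < Module.finrank ℝ (H y) + 1 := by linarith
  have h4 : Module.finrank ℝ (H x) < Module.finrank ℝ (H y) + 1 := by exact_mod_cast h3
  omega

/-- The projections to the fibers of a lower semicontinuous family vary continuously as long as
the dimension does not jump up. -/
theorem IsLscFamily.tendsto_starProjection (hH : IsLscFamily H) (x : Y) (u : W) :
    Tendsto (fun y => (H y).starProjection u)
      (𝓝[{y | Module.finrank ℝ (H y) ≤ Module.finrank ℝ (H x)}] x)
      (𝓝 ((H x).starProjection u)) := by
  let b := stdOrthonormalBasis ℝ W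
  have hsum : Tendsto
      (fun y => ∑ i, ‖(H y).starProjection (b i) - (H x).starProjection (b i)‖ ^ 2)
      (𝓝[{y | Module.finrank ℝ (H y) ≤ Module.finrank ℝ (H x)}] x) (𝓝 0) := by
    have h := ((hH.tendsto_sum_inner x b).mono_left (nhdsWithin_le_nhds
      (s := {y | Module.finrank ℝ (H y) ≤ Module.finrank ℝ (H x)}))).const_mul 2
    -- When `dim H y ≤ dim H x`, the squared distance is at most `2 dim H x - 2 tr (P_y P_x)`, which
    -- tends to `0`.
    have h' := h.const_sub (2 * (Module.finrank ℝ (H x) : ℝ))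
    rw [sub_self] at h'
    refine squeeze_zero' (Eventually.of_forall fun y => by positivity) ?_ h'
    filter_upwards [self_mem_nhdsWithin] with y hy
    have hy' : (Module.finrank ℝ (H y) : ℝ) ≤ Module.finrank ℝ (H x) := by exact_mod_cast hy
    rw [sum_norm_sq_starProjection_sub]
    linarith
  have hb : ∀ i, Tendsto (fun y => (H y).starProjection (b i))
      (𝓝[{y | Module.finrank ℝ (H y) ≤ Module.finrank ℝ (H x)}] x)
      (𝓝 ((H x).starProjection (b i))) := by
    intro i
    rw [tendsto_iff_norm_sub_tendsto_zero]
    have : Tendsto (fun y => ‖(H y).starProjection (b i) - (H x).starProjection (b i)‖ ^ 2)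
        (𝓝[{y | Module.finrank ℝ (H y) ≤ Module.finrank ℝ (H x)}] x) (𝓝 0) :=
      squeeze_zero (fun y => by positivity)
        (fun y => Finset.single_le_sum
          (f := fun i => ‖(H y).starProjection (b i) - (H x).starProjection (b i)‖ ^ 2)
          (fun j _ => by positivity) (Finset.mem_univ i)) hsum
    simpa using this.sqrt
  rw [← b.sum_repr u]
  simp only [map_sum, map_smul]
  exact tendsto_finsetSum _ fun i _ => (hb i).const_smul _

end Projections

/-! ### Linear maps depending on finitely many values -/

section Depth

variable {Y M N : Type*} [AddCommGroup M] [Module ℝ M] [AddCommGroup N] [Module ℝ N]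

/-- A linear map on families of vectors has depth at most `d` if it only depends on the values
of the family at `d` points. -/
def HasDepth (d : ℕ) (T : (Y → M) →ₗ[ℝ] N) : Prop :=
  ∃ S : Finset Y, S.card ≤ d ∧ ∀ v : Y → M, (∀ y ∈ S, v y = 0) → T v = 0

theorem HasDepth.zero : HasDepth 0 (0 : (Y → M) →ₗ[ℝ] N) :=
  ⟨∅, le_rfl, fun _ _ => rfl⟩

theorem HasDepth.mono {d e : ℕ} {T : (Y → M) →ₗ[ℝ] N} (h : HasDepth d T) (hde : d ≤ e) :
    HasDepth e T :=
  let ⟨S, hS, hT⟩ := h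
  ⟨S, hS.trans hde, hT⟩

theorem HasDepth.proj (x : Y) : HasDepth 1 (LinearMap.proj x : (Y → M) →ₗ[ℝ] M) :=
  ⟨{x}, by simp, fun v hv => by simpa using hv⟩

theorem HasDepth.add {d e : ℕ} {T U : (Y → M) →ₗ[ℝ] N} (hT : HasDepth d T) (hU : HasDepth e U) :
    HasDepth (d + e) (T + U) := by
  classical
  obtain ⟨S, hS, hT⟩ := hT
  obtain ⟨S', hS', hU⟩ := hU
  refine ⟨S ∪ S', (Finset.card_union_le _ _).trans (add_le_add hS hS'), fun v hv => ?_⟩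
  rw [LinearMap.add_apply, hT v fun y hy => hv y (Finset.mem_union_left _ hy),
    hU v fun y hy => hv y (Finset.mem_union_right _ hy), add_zero]

theorem HasDepth.comp {d : ℕ} {T : (Y → M) →ₗ[ℝ] N} (hT : HasDepth d T) (f : N →ₗ[ℝ] N) :
    HasDepth d (f ∘ₗ T) := by
  obtain ⟨S, hS, hT⟩ := hT
  exact ⟨S, hS, fun v hv => by simp [hT v hv]⟩

theorem HasDepth.sum_smul {ι : Type*} {d : ℕ} {T : ι → (Y → M) →ₗ[ℝ] N}
    (hT : ∀ i, HasDepth d (T i)) (a : ι → ℝ) (s : Finset ι) :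
    HasDepth (s.card * d) (∑ i ∈ s, a i • T i) := by
  classical
  choose S hS hT using hT
  refine ⟨s.biUnion S, Finset.card_biUnion_le_card_mul _ _ _ fun i _ => hS i, fun v hv => ?_⟩
  rw [LinearMap.sum_apply]
  refine Finset.sum_eq_zero fun i hi => ?_
  rw [LinearMap.smul_apply, hT i v fun y hy => hv y (Finset.mem_biUnion.2 ⟨i, hi, hy⟩), smul_zero]

theorem HasDepth.exists_sum {d : ℕ} {T : (Y → M) →ₗ[ℝ] N} (hT : HasDepth d T) :
    ∃ (S : Finset Y) (A : Y → M →ₗ[ℝ] N), S.card ≤ d ∧ ∀ v, T v = ∑ y ∈ S, A y (v y) := by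
  classical
  obtain ⟨S, hS, hT⟩ := hT
  refine ⟨S, fun y => T ∘ₗ LinearMap.single ℝ (fun _ => M) y, hS, fun v => ?_⟩
  rw [← sub_eq_zero]
  simp only [LinearMap.comp_apply, ← map_sum, ← map_sub]
  refine hT _ fun y hy => ?_
  simp [Finset.sum_apply, Pi.single_apply, hy]

end Depth

theorem norm_sum_smul_sub_le {W ι : Type*} [NormedAddCommGroup W] [NormedSpace ℝ W]
    {s : Finset ι} {a : ι → ℝ} (ha : ∀ i, 0 ≤ a i) (hsum : ∑ i ∈ s, a i = 1)
    {g : ι → W} {c : W} {ε : ℝ} (hg : ∀ i, a i ≠ 0 → ‖g i - c‖ ≤ ε) :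
    ‖∑ i ∈ s, a i • g i - c‖ ≤ ε := by
  have h : ∑ i ∈ s, a i • g i - c = ∑ i ∈ s, a i • (g i - c) := by
    simp only [smul_sub, Finset.sum_sub_distrib, ← Finset.sum_smul, hsum, one_smul]
  rw [h]
  calc _ ≤ ∑ i ∈ s, ‖a i • (g i - c)‖ := norm_sum_le _ _
    _ ≤ ∑ i ∈ s, a i * ε := by
        refine Finset.sum_le_sum fun i _ => ?_
        rw [norm_smul, Real.norm_of_nonneg (ha i)]
        rcases eq_or_ne (a i) 0 with h0 | h0
        · simp [h0]
        · exact mul_le_mul_of_nonneg_left (hg i h0) (ha i)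
    _ = ε := by rw [← Finset.sum_mul, hsum, one_mul]

/-! ### Section operators, stratum by stratum -/

section Sections

variable {V : Type*} [NormedAddCommGroup V] [NormedSpace ℝ V] [FiniteDimensional ℝ V] {X : Set V}
variable {W : Type*} [NormedAddCommGroup W] [InnerProductSpace ℝ W] [FiniteDimensional ℝ W]
variable {H : X → Submodule ℝ W}

/-- The family of affine subspaces `v x + H x`, where `v x` is orthogonal to `H x`, is lower
semicontinuous: each point of a fiber is a limit of its projections to the neighboring fibers. -/
structure IsLscTranslation {Y : Type*} [TopologicalSpace Y] (H : Y → Submodule ℝ W) (v : Y → W) :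
    Prop where
  mem_orthogonal : ∀ x, v x ∈ (H x)ᗮ
  tendsto : ∀ x p, p - v x ∈ H x →
    Tendsto (fun y => v y + (H y).starProjection p) (𝓝 x) (𝓝 p)

theorem IsLscTranslation.isLscFamily {Y : Type*} [TopologicalSpace Y] {H : Y → Submodule ℝ W}
    {v : Y → W} (hv : IsLscTranslation H v) : IsLscFamily H := by
  intro x h hh
  have h1 := hv.tendsto x (v x + h) (by simpa using hh)
  have h2 := hv.tendsto x (v x) (by simp)
  simpa using h1.sub h2

theorem IsLscTranslation.tendsto_of_finrank_le {Y : Type*} [TopologicalSpace Y]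
    {H : Y → Submodule ℝ W} {v : Y → W} (hv : IsLscTranslation H v) (x : Y) :
    Tendsto v (𝓝[{y | Module.finrank ℝ (H y) ≤ Module.finrank ℝ (H x)}] x) (𝓝 (v x)) := by
  have h1 := (hv.tendsto x (v x) (by simp)).mono_left (nhdsWithin_le_nhds
    (s := {y | Module.finrank ℝ (H y) ≤ Module.finrank ℝ (H x)}))
  have h2 := h1.sub (hv.isLscFamily.tendsto_starProjection x (v x))
  rw [(H x).starProjection_apply_eq_zero_iff.2 (hv.mem_orthogonal x)] at h2
  simpa using h2

/-- Near `x`, `v y + P_y (v x)` is close to `v x` and `‖P_y (v x)‖ ≤ ‖v x‖`, so `v` is locally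
bounded although possibly discontinuous; compactness does the rest. -/
theorem IsLscTranslation.bddAbove {Y : Type*} [TopologicalSpace Y] [CompactSpace Y]
    {H : Y → Submodule ℝ W} {v : Y → W} (hv : IsLscTranslation H v) :
    BddAbove (Set.range fun y => ‖v y‖) := by
  have hloc : ∀ x ∈ Set.univ, ∃ t ∈ 𝓝[Set.univ] x, BddAbove (Set.image (fun y => ‖v y‖) t) := by
    intro x _
    rw [nhdsWithin_univ]
    have h := (hv.tendsto x (v x) (by simp)).norm.eventually
      (gt_mem_nhds (lt_add_one ‖v x‖))
    refine ⟨_, h, ‖v x‖ + 1 + ‖v x‖, ?_⟩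
    rintro _ ⟨y, hy, rfl⟩
    have h1 : ‖v y‖ ≤ ‖v y + (H y).starProjection (v x)‖ + ‖(H y).starProjection (v x)‖ := by
      simpa using norm_sub_le (v y + (H y).starProjection (v x)) ((H y).starProjection (v x))
    have h2 := (H y).norm_starProjection_apply_le (v x)
    have h3 : ‖v y + (H y).starProjection (v x)‖ < ‖v x‖ + 1 := hy
    change ‖v y‖ ≤ _
    linarith
  rw [← Set.image_univ]
  refine isCompact_univ.induction_on (p := fun t => BddAbove (Set.image (fun y => ‖v y‖) t)) (by simp)
    (fun s t hst ht => ht.mono (Set.image_mono hst))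
    (fun s t hs ht => by rw [Set.image_union]; exact hs.union ht) hloc

/-- `T` assigns to a family `v`, linearly, a section of `(v x + H x)` over `E` which is bounded
by `K` times any bound of `v`. -/
def IsSectionOperatorOn {Y : Type*} [TopologicalSpace Y] (H : Y → Submodule ℝ W) (E : Set Y)
    (K : ℝ) (T : Y → (Y → W) →ₗ[ℝ] W) : Prop :=
  ∀ v, IsLscTranslation H v →
    ContinuousOn (fun x => T x v) E ∧ (∀ x ∈ E, T x v - v x ∈ H x) ∧
      ∀ B, (∀ x, ‖v x‖ ≤ B) → ∀ x ∈ E, ‖T x v‖ ≤ K * B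

/-- A function on a closed set `E` extends to the complement by an averaging operator of bounded
depth, continuously at all points where it is continuous. -/
theorem exists_averaging_operator {W : Type*} [NormedAddCommGroup W] [NormedSpace ℝ W]
    {E : Set X} (hE : IsClosed E) :
    ∃ (s : X → Finset X) (w : X → X → ℝ) (π : X → X),
      (∀ x, (s x).card ≤ 5 ^ Module.finrank ℝ V) ∧
      ∀ g : X → W,
        (∀ x ∉ E, ContinuousAt (fun z => ∑ p ∈ s z, w z p • g (π p)) x) ∧
        (∀ x ∈ E, ContinuousWithinAt g E x →
          Tendsto (fun z => ∑ p ∈ s z, w z p • g (π p)) (𝓝[Eᶜ] x) (𝓝 (g x))) ∧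
        ∀ B, 0 ≤ B → (∀ x ∈ E, ‖g x‖ ≤ B) → ∀ x ∉ E, ‖∑ p ∈ s x, w x p • g (π p)‖ ≤ B := by
  classical
  rcases E.eq_empty_or_nonempty with rfl | hne
  · exact ⟨fun _ => ∅, fun _ _ => 0, id, by simp, fun g =>
      ⟨fun x _ => by simpa using continuousAt_const, by simp,
        fun B hB _ x _ => by simpa using hB⟩⟩
  obtain ⟨w, π, hπ, hw0, hloc, hwc, hdist⟩ := exists_whitney_partition hE hne
  choose! s hs hsloc using hloc
  have hs1 : ∀ x ∉ E, (∀ p ∉ s x, w x p = 0) ∧ ∑ p ∈ s x, w x p = 1 :=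
    fun x hx => (hsloc x hx).self_of_nhds
  refine ⟨fun x => if x ∈ E then ∅ else s x, w, π, fun x => ?_, fun g => ⟨?_, ?_, ?_⟩⟩
  · dsimp only
    split_ifs with hx
    · simp
    · exact hs x hx
  · intro x hx
    have hEq : (fun z => ∑ p ∈ s x, w z p • g (π p)) =ᶠ[𝓝 x]
        fun z => ∑ p ∈ (if z ∈ E then ∅ else s z), w z p • g (π p) := by
      filter_upwards [hsloc x hx, hE.isOpen_compl.mem_nhds hx] with z hz hzE
      rw [if_neg hzE]
      -- The index set `s z` may jump with `z`; both finite sums equal the same `finsum`, so near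
      -- `x` the fixed set `s x` can be used.
      have h1 : ∀ t : Finset X, (∀ p ∉ t, w z p = 0) →
          ∑ᶠ p, w z p • g (π p) = ∑ p ∈ t, w z p • g (π p) := by
        intro t ht
        refine finsum_eq_sum_of_support_subset _ fun p hp => ?_
        by_contra hpt
        exact hp (by simp [ht p hpt])
      rw [← h1 _ hz.1, ← h1 _ (hs1 z hzE).1]
    refine ContinuousAt.congr ?_ hEq
    exact tendsto_finsetSum _ fun p _ => (hwc x hx p).smul continuousAt_const
  · intro x hx hg
    rw [Metric.tendsto_nhds]
    intro ε hε
    obtain ⟨δ, hδ, hgδ⟩ := Metric.continuousWithinAt_iff.1 hg (ε / 2) (by positivity)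
    filter_upwards [self_mem_nhdsWithin,
      nhdsWithin_le_nhds (Metric.ball_mem_nhds x (show 0 < δ / 4 by positivity))] with z hzE hz
    rw [if_neg hzE, dist_eq_norm]
    refine (norm_sum_smul_sub_le (hw0 z) (hs1 z hzE).2 fun p hp => ?_).trans_lt (half_lt_self hε)
    rw [← dist_eq_norm]
    refine (hgδ (hπ p) ?_).le
    have h1 := hdist z hzE p hp
    have h2 : Metric.infDist z E ≤ dist z x := Metric.infDist_le_dist_of_mem hx
    have h3 := dist_triangle (π p) z x
    rw [dist_comm (π p) z] at h3
    have h4 : dist z x < δ / 4 := hz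
    linarith
  · intro B _ hg x hx
    dsimp only
    rw [if_neg hx]
    simpa using norm_sum_smul_sub_le (hw0 x) (hs1 x hx).2 (g := fun p => g (π p)) (c := 0)
      fun p _ => by simpa using hg _ (hπ p)

/-- Extension of section operators across a stratum. -/
theorem IsSectionOperatorOn.exists_extend (hH : IsLscFamily H) {k d : ℕ} {K : ℝ} (hK : 0 ≤ K)
    {T : X → (X → W) →ₗ[ℝ] W} (hT : IsSectionOperatorOn H {x | Module.finrank ℝ (H x) < k} K T)
    (hd : ∀ x, HasDepth d (T x)) :
    ∃ T' : X → (X → W) →ₗ[ℝ] W,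
      IsSectionOperatorOn H {x | Module.finrank ℝ (H x) < k + 1} (1 + K) T' ∧
        ∀ x, HasDepth (1 + 5 ^ Module.finrank ℝ V * d) (T' x) := by
  classical
  set E : Set X := {x | Module.finrank ℝ (H x) < k} with hEdef
  have hE : IsClosed E := hH.isClosed_finrank_lt k
  obtain ⟨s, w, π, hs, hop⟩ := exists_averaging_operator (W := W) hE
  let U : X → (X → W) →ₗ[ℝ] W := fun x => LinearMap.proj x +
    ((H x).starProjection : W →ₗ[ℝ] W) ∘ₗ ∑ p ∈ s x, w x p • T (π p)
  have hU : ∀ x v, U x v =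
      v x + (H x).starProjection (∑ p ∈ s x, w x p • T (π p) v) := by
    intro x v
    simp [U]
  refine ⟨fun x => if x ∈ E then T x else U x, fun v hv => ?_, fun x => ?_⟩
  · obtain ⟨hTc, hTm, hTb⟩ := hT v hv
    obtain ⟨hc, hlim, hbd⟩ := hop fun y => T y v
    refine ⟨fun x hx => ?_, fun x hx => ?_, fun B hB x hx => ?_⟩
    · by_cases hxE : x ∈ E
      · have hval : (if x ∈ E then T x else U x) v = T x v := by rw [if_pos hxE]
        rw [ContinuousWithinAt, hval]
        have hle : 𝓝[{x | Module.finrank ℝ (H x) < k + 1}] x ≤ 𝓝[E] x ⊔ 𝓝[Eᶜ] x := by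
          rw [← nhdsWithin_union, Set.union_compl_self]
          exact nhdsWithin_mono _ (Set.subset_univ _)
        refine Tendsto.mono_left ?_ hle
        refine Tendsto.sup ?_ ?_
        · refine (hTc x hxE).congr' ?_
          filter_upwards [self_mem_nhdsWithin] with z hz
          rw [if_pos hz]
        · have h1 := hlim x hxE (hTc x hxE)
          have h2 := (hv.tendsto x (T x v) (hTm x hxE)).mono_left
            (nhdsWithin_le_nhds (s := Eᶜ))
          -- Off `E` the new value is `(v z + P_z (T x v)) + P_z (average - T x v)`; the second term
          -- vanishes in the limit because projections are contractions.
          have h3 : Tendsto (fun z => (H z).starProjection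
              (∑ p ∈ s z, w z p • T (π p) v - T x v)) (𝓝[Eᶜ] x) (𝓝 0) := by
            refine squeeze_zero_norm (fun z => (H z).norm_starProjection_apply_le _) ?_
            simpa using (h1.sub_const (T x v)).norm
          have h4 := h2.add h3
          rw [add_zero] at h4
          refine h4.congr' ?_
          filter_upwards [self_mem_nhdsWithin] with z hz
          rw [if_neg hz, hU, map_sub]
          abel
      · have hval : (if x ∈ E then T x else U x) v = U x v := by rw [if_neg hxE]
        have hk : Module.finrank ℝ (H x) = k := by
          simp only [hEdef, Set.mem_ofPred_eq] at hx hxE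
          omega
        have hset : {y | Module.finrank ℝ (H y) < k + 1} =
            {y | Module.finrank ℝ (H y) ≤ Module.finrank ℝ (H x)} := by
          ext y
          simp only [Set.mem_ofPred_eq, hk]
          omega
        rw [ContinuousWithinAt, hval, hset, hU]
        set F : X → W := fun z => ∑ p ∈ s z, w z p • T (π p) v
        have h1 := hv.tendsto_of_finrank_le x
        have h2 := hH.tendsto_starProjection x (F x)
        have hFx : Tendsto F (𝓝[{y | Module.finrank ℝ (H y) ≤ Module.finrank ℝ (H x)}] x)
            (𝓝 (F x)) := (hc x hxE).mono_left nhdsWithin_le_nhds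
        have h3 : Tendsto (fun z => (H z).starProjection (F z - F x))
            (𝓝[{y | Module.finrank ℝ (H y) ≤ Module.finrank ℝ (H x)}] x) (𝓝 0) := by
          refine squeeze_zero_norm (fun z => (H z).norm_starProjection_apply_le _) ?_
          simpa using (hFx.sub_const (F x)).norm
        have h4 := h1.add (h2.add h3)
        rw [add_zero] at h4
        refine h4.congr' ?_
        filter_upwards [nhdsWithin_le_nhds (hE.isOpen_compl.mem_nhds hxE)] with z hz
        rw [if_neg hz, hU, map_sub]
        abel
    · dsimp only
      split_ifs with hxE
      · exact hTm x hxE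
      · rw [hU, add_sub_cancel_left]
        exact (H x).starProjection_apply_mem _
    · have hB0 : 0 ≤ B := (norm_nonneg _).trans (hB x)
      dsimp only
      split_ifs with hxE
      · refine (hTb B hB x hxE).trans ?_
        linarith
      · rw [hU]
        refine (norm_add_le _ _).trans ?_
        have h1 := (H x).norm_starProjection_apply_le (∑ p ∈ s x, w x p • T (π p) v)
        have h2 := hbd (K * B) (mul_nonneg hK hB0) (hTb B hB) x hxE
        have h3 := hB x
        linarith
  · dsimp only
    split_ifs with hxE
    · refine (hd x).mono ?_
      have : d ≤ 5 ^ Module.finrank ℝ V * d := Nat.le_mul_of_pos_left d (by positivity)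
      omega
    · refine (HasDepth.proj x).add (HasDepth.comp ?_ _)
      exact (HasDepth.sum_smul (fun p => hd (π p)) (w x) (s x)).mono
        (Nat.mul_le_mul_right d (hs x))

variable (V) in
/-- The depth of the section operator over the points with fibers of dimension less than `k`. -/
noncomputable def sectionDepth : ℕ → ℕ
  | 0 => 0
  | k + 1 => 1 + 5 ^ Module.finrank ℝ V * sectionDepth k

theorem exists_isSectionOperatorOn (hH : IsLscFamily H) (k : ℕ) :
    ∃ T : X → (X → W) →ₗ[ℝ] W,
      IsSectionOperatorOn H {x | Module.finrank ℝ (H x) < k} k T ∧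
        ∀ x, HasDepth (sectionDepth V k) (T x) := by
  induction k with
  | zero => exact ⟨fun _ => 0, fun v _ => by simp [ContinuousOn], fun _ => HasDepth.zero⟩
  | succ k ih =>
    obtain ⟨T, hT, hd⟩ := ih
    obtain ⟨T', hT', hd'⟩ := hT.exists_extend hH k.cast_nonneg hd
    refine ⟨T', ?_, hd'⟩
    rwa [Nat.cast_succ, add_comm (k : ℝ)]

end Sections

/-! ### From Glaeser stability to the theorem -/

theorem SingularAffineBundle.IsGlaeserStable.isLscTranslation {Y : Type*} [TopologicalSpace Y]
    {r : ℕ} {H₀ : HomogeneousBundle Y r} {v : Y → EuclideanSpace ℝ (Fin r)}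
    (hv : ∀ x, v x ∈ (H₀ x)ᗮ) (h : (SingularAffineBundle.translate v H₀).IsGlaeserStable) :
    IsLscTranslation H₀ v := by
  refine ⟨hv, fun x p hp => ?_⟩
  have hmem : p ∈ (SingularAffineBundle.translate v H₀).glaeserRefinement x := by
    rw [h]
    simpa [SingularAffineBundle.translate, AffineSubspace.mem_mk'] using hp
  have hlim := hmem.2
  rw [tendsto_iff_edist_tendsto_0]
  refine tendsto_of_tendsto_of_tendsto_of_le_of_le tendsto_const_nhds hlim
    (fun _ => zero_le) fun y => ?_
  refine Metric.le_infEDist.2 fun q hq => ?_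
  have hq' : q - v y ∈ H₀ y := by
    simpa [SingularAffineBundle.translate, AffineSubspace.mem_mk'] using hq
  -- The residual of `p` is a projection of `p - q` for every `q` in the fiber, so its norm is at
  -- most `dist(p, H_y)`.
  have h1 : (H₀ y)ᗮ.starProjection (p - q) = p - (v y + (H₀ y).starProjection p) := by
    have h2 : (H₀ y).starProjection q = q - v y := by
      have := map_add (H₀ y).starProjection (q - v y) (v y)
      rwa [sub_add_cancel, (H₀ y).starProjection_apply_eq_zero_iff.2 (hv y), add_zero,
        (H₀ y).starProjection_eq_self_iff.2 hq'] at this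
    rw [Submodule.starProjection_orthogonal_val, map_sub, h2]
    abel
  rw [edist_comm, edist_eq_enorm_sub, edist_eq_enorm_sub, ← h1, enorm_le_iff_norm_le]
  exact Submodule.norm_starProjection_apply_le _ _

theorem isCompact_closedCube {n : ℕ} (c : EuclideanSpace ℝ (Fin n)) (δ : ℝ) :
    IsCompact (closedCube c δ) := by
  have h : closedCube c δ = Set.preimage (EuclideanSpace.equiv (Fin n) ℝ).toHomeomorph
      (Set.univ.pi fun i => Metric.closedBall (c i) (δ / 2)) := by
    ext x
    simp [closedCube, Real.dist_eq]
  rw [h, Homeomorph.isCompact_preimage]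
  exact isCompact_univ_pi fun i => isCompact_closedBall _ _

theorem theorem3 (n r : ℕ) (hn : 0 < n) (hr : 0 < r) :
    ∃ (C : ℝ) (d : ℕ),
      ∀ (c : EuclideanSpace ℝ (Fin n)) (δ : ℝ), 0 < δ →
      ∀ H₀ : HomogeneousBundle (closedCube c δ) r,
      ∃ (S : closedCube c δ → Finset (closedCube c δ))
        (A : closedCube c δ → closedCube c δ →
          (EuclideanSpace ℝ (Fin r) →ₗ[ℝ] EuclideanSpace ℝ (Fin r))),
        (∀ x, (S x).card ≤ d) ∧
        ∀ v : closedCube c δ → EuclideanSpace ℝ (Fin r),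
          (∀ x, v x ∈ (H₀ x)ᗮ) →
          (SingularAffineBundle.translate v H₀).IsGlaeserStable →
          (SingularAffineBundle.translate v H₀).IsSection
              (fun x => ∑ y ∈ S x, A x y (v y)) ∧
            BddAbove (Set.range fun y => ‖v y‖) ∧
            ∀ x, ‖∑ y ∈ S x, A x y (v y)‖ ≤ C * ⨆ y, ‖v y‖ := by
  refine ⟨(r + 1 : ℕ), sectionDepth (EuclideanSpace ℝ (Fin n)) (r + 1), fun c δ _ H₀ => ?_⟩
  by_cases hH : IsLscFamily H₀
  · obtain ⟨T, hT, hd⟩ := exists_isSectionOperatorOn hH (r + 1)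
    have huniv : {x | Module.finrank ℝ (H₀ x) < r + 1} = Set.univ := by
      refine Set.eq_univ_of_forall fun x => ?_
      have := (H₀ x).finrank_le
      rw [finrank_euclideanSpace_fin] at this
      exact Nat.lt_succ_of_le this
    rw [huniv] at hT
    choose S A hS hA using fun x => (hd x).exists_sum
    refine ⟨S, A, hS, fun v hv hst => ?_⟩
    have hlsc := hst.isLscTranslation hv
    have hcpt : CompactSpace (closedCube c δ) :=
      isCompact_iff_compactSpace.1 (isCompact_closedCube c δ)
    have hbdd := hlsc.bddAbove
    obtain ⟨hc, hm, hb⟩ := hT v hlsc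
    simp only [← hA]
    refine ⟨⟨continuousOn_univ.1 hc, fun x => ?_⟩, hbdd, fun x => ?_⟩
    · simpa [SingularAffineBundle.translate, AffineSubspace.mem_mk'] using hm x (Set.mem_univ x)
    · exact hb _ (fun y => le_ciSup hbdd y) x (Set.mem_univ x)
  -- Without lower semicontinuity no admissible `v` is stable, so any choice works.
  · exact ⟨fun _ => ∅, fun _ _ => 0, by simp, fun v hv hst =>
      absurd (hst.isLscTranslation hv).isLscFamily hH⟩
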